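/- Let $Y$ be a real Banach space with its Borel $\sigma$-algebra, let $X\subset Y$ be compact with the metric $d(u_1,u_2)=\|u_1-u_2\|$, and let $\mathcal P(X)$ be the set of Borel probability measures on $X$ with the topology of weak convergence and the corresponding Borel $\sigma$-algebra. For $\mu_1,\mu_2\in\mathcal P(X)$, a coupling for $(\mu_1,\mu_2)$ is a pair $(\zeta_1,\zeta_2)$ of $X$-valued random variables on a common probability space such that the law of $\zeta_i$ is $\mu_i$ for $i=1,2$. For $\varepsilon\ge 0$ put $$d_\varepsilon(u_1,u_2)=\begin{cases}1,& d(u_1,u_2)>\varepsilon,\\ 0,& d(u_1,u_2)\le\varepsilon,\end{cases}\qquad C_\varepsilon(\mu_1,\mu_2)=\inf_{(\zeta_1,\zeta_2)}\mathbb E\,d_\varepsilon(\zeta_1,\zeta_2),$$ where the infimum is taken over all couplings $(\zeta_1,\zeta_2)$ for $(\mu_1,\mu_2)$. **Proposition 5.4.** Let $Z$ be a measurable space and let $z\mapsto\mu_i^z$, $i=1,2$, be measurable maps from $Z$ to $\mathcal P(X)$. Then for any measurable function $\varepsilon:Z\to(0,\infty)$ and any $\theta\in(0,1)$ there are a probability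 space $(\Omega,\mathcal F,\mathbb P)$ and functions $\xi_1,\xi_2:\Omega\times Z\to X$, $(\omega,z)\mapsto\xi_i^z(\omega)$, measurable as maps from $\Omega\times Z$ (with the product $\sigma$-algebra) to $Y$, such that for every $z\in Z$ the pair $(\xi_1^z,\xi_2^z)$ is a coupling for $(\mu_1^z,\mu_2^z)$ and $$\mathbb E\,d_{\varepsilon(z)}(\xi_1^z,\xi_2^z)\le C_{\theta\varepsilon(z)}(\mu_1^z,\mu_2^z).$$ -/

import Mathlib

open MeasureTheory

universe u v

noncomputable section

namespace EpsOptimal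

/-- The function `d_ε(u₁, u₂)`, equal to `1` if `d(u₁, u₂) > ε` and to `0` if `d(u₁, u₂) ≤ ε`. -/
def dEps {X : Type u} [MetricSpace X] (ε : ℝ) (u₁ u₂ : X) : ℝ :=
  open Classical in if dist u₁ u₂ > ε then 1 else 0

/-- `(ζ₁, ζ₂)`, defined on the probability space `(Ω, P)`, is a coupling for `(μ₁, μ₂)`: both
components are `X`-valued random variables, and the law of `ζᵢ` is `μᵢ`. -/
structure IsCoupling {X : Type u} [MeasurableSpace X] {Ω : Type v} [MeasurableSpace Ω]
    (P : Measure Ω) (ζ₁ ζ₂ : Ω → X) (μ₁ μ₂ : ProbabilityMeasure X) : Prop where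
  measurable_fst : Measurable ζ₁
  measurable_snd : Measurable ζ₂
  map_fst : P.map ζ₁ = (μ₁ : Measure X)
  map_snd : P.map ζ₂ = (μ₂ : Measure X)

/-- The values `E d_ε(ζ₁, ζ₂)` over all couplings `(ζ₁, ζ₂)` for `(μ₁, μ₂)`, on all probability
spaces. The universe of `X` is enough for the sample spaces: every coupling has the same value as
the pair of projections of `X × X` under its joint law. -/
def couplingCosts {X : Type u} [MetricSpace X] [MeasurableSpace X]
    (ε : ℝ) (μ₁ μ₂ : ProbabilityMeasure X) : Set ℝ :=
  {c | ∃ (Ω : Type u) (_ : MeasurableSpace Ω) (P : Measure Ω) (ζ₁ ζ₂ : Ω → X),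
    IsProbabilityMeasure P ∧ IsCoupling P ζ₁ ζ₂ μ₁ μ₂ ∧
      c = ∫ ω, dEps ε (ζ₁ ω) (ζ₂ ω) ∂P}

/-- The `ε`-optimal cost `C_ε(μ₁, μ₂)`: the infimum of `E d_ε(ζ₁, ζ₂)` over all couplings
`(ζ₁, ζ₂)` for `(μ₁, μ₂)`. The set is non-empty and consists of non-negative numbers, see below. -/
def optimalCost {X : Type u} [MetricSpace X] [MeasurableSpace X]
    (ε : ℝ) (μ₁ μ₂ : ProbabilityMeasure X) : ℝ :=
  sInf (couplingCosts ε μ₁ μ₂)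

theorem couplingCosts_nonempty {X : Type u} [MetricSpace X] [MeasurableSpace X]
    (ε : ℝ) (μ₁ μ₂ : ProbabilityMeasure X) : (couplingCosts ε μ₁ μ₂).Nonempty :=
  ⟨_, X × X, inferInstance, (μ₁ : Measure X).prod (μ₂ : Measure X), Prod.fst, Prod.snd,
    inferInstance, ⟨measurable_fst, measurable_snd, by simp, by simp⟩, rfl⟩

theorem couplingCosts_nonneg {X : Type u} [MetricSpace X] [MeasurableSpace X]
    (ε : ℝ) (μ₁ μ₂ : ProbabilityMeasure X) : ∀ c ∈ couplingCosts ε μ₁ μ₂, 0 ≤ c := by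
  rintro c ⟨Ω, _, P, ζ₁, ζ₂, _, _, rfl⟩
  refine integral_nonneg fun ω => ?_
  simp only [dEps, Pi.zero_apply]
  split_ifs <;> norm_num

/-- On a second countable space, `E d_ε(ζ₁, ζ₂)` is a genuine (convergent) integral. -/
theorem integrable_dEps {X : Type u} [MetricSpace X] [SecondCountableTopology X]
    [MeasurableSpace X] [BorelSpace X] {Ω : Type v} [MeasurableSpace Ω] (P : Measure Ω)
    [IsProbabilityMeasure P] (ε : ℝ) {ζ₁ ζ₂ : Ω → X} (h₁ : Measurable ζ₁) (h₂ : Measurable ζ₂) :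
    Integrable (fun ω => dEps ε (ζ₁ ω) (ζ₂ ω)) P := by
  have hm : Measurable (fun ω => dEps ε (ζ₁ ω) (ζ₂ ω)) := by
    unfold dEps
    exact Measurable.ite (measurableSet_lt measurable_const (h₁.dist h₂))
      measurable_const measurable_const
  refine Integrable.of_bound hm.aestronglyMeasurable 1 (Filter.Eventually.of_forall fun ω => ?_)
  simp only [dEps]
  split_ifs <;> norm_num

end EpsOptimal

end

namespace EpsOptimal

open Set Topology ProbabilityTheory Filter
open scoped ENNReal

/-! The strict inequality `θε < ε` leaves room to discretise. Cut `X` into finitely many classes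
with representatives within `δ`, and let `E` hold the pairs of classes whose representatives are at
distance at most `η + 2δ`. The class masses then pose a finite transport problem: place as much mass
as possible on `E`.

A coupling, restricted to `{d ≤ η}`, puts its mass on `E`, so `1 - max ≤ C_η`
(`one_sub_le_optimalCost`). Conversely an optimal plan, spread over each pair of classes as a
product measure, is a coupling whose points at distance beyond `η + 4δ` carry mass at most `1 -
max`.

Measurability in `z` is obtained by hand: the finite problem is solved by recursion on `E`, each
stage being a one-variable maximisation whose least maximiser is measurable. The scale `δ` is then
chosen from a countable family depending on `z`, and the resulting kernel is realised by random
variables on `[0, 1]`. -/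

/-- A jointly continuous function of `(x, s)` attains its maximum over `s ∈ [0, 1]` at a point
depending measurably on `x`; the maximum depends continuously on `x`. -/
theorem exists_measurable_argmax_Icc {α : Type*} [TopologicalSpace α] [MeasurableSpace α]
    [BorelSpace α] {f : α → ℝ → ℝ} (hf : Continuous (Function.uncurry f)) :
    ∃ (V τ : α → ℝ), Continuous V ∧ Measurable τ ∧ (∀ x, τ x ∈ Icc (0 : ℝ) 1) ∧
      (∀ x, f x (τ x) = V x) ∧ ∀ x, ∀ s ∈ Icc (0 : ℝ) 1, f x s ≤ V x := by
  have hfx (x : α) : Continuous (f x) := by fun_prop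
  have hV (c : ℝ) : Continuous fun x => sSup (f x '' Icc 0 c) :=
    isCompact_Icc.continuous_sSup hf
  have hbdd (x : α) (c : ℝ) : BddAbove (f x '' Icc 0 c) :=
    (isCompact_Icc.image (hfx x)).bddAbove
  let V : α → ℝ := fun x => sSup (f x '' Icc 0 1)
  let S : α → Set ℝ := fun x => Icc 0 1 ∩ {s | V x ≤ f x s}
  have hle (x : α) (s : ℝ) (hs : s ∈ Icc (0 : ℝ) 1) : f x s ≤ V x :=
    le_csSup (hbdd x 1) (mem_image_of_mem _ hs)
  have hattained (x : α) (c : ℝ) (hc : 0 ≤ c) :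
      ∃ s ∈ Icc (0 : ℝ) c, sSup (f x '' Icc 0 c) = f x s :=
    isCompact_Icc.exists_sSup_image_eq (nonempty_Icc.2 hc) (hfx x).continuousOn
  have hScompact (x : α) : IsCompact (S x) :=
    isCompact_Icc.inter_right (isClosed_le continuous_const (hfx x))
  have hSne (x : α) : (S x).Nonempty := by
    obtain ⟨s, hs, h⟩ := hattained x 1 zero_le_one
    exact ⟨s, hs, h.le⟩
  have hmem (x : α) : sInf (S x) ∈ S x := (hScompact x).sInf_mem (hSne x)
  refine ⟨V, fun x => sInf (S x), hV 1, ?_, fun x => (hmem x).1,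
    fun x => le_antisymm (hle x _ (hmem x).1) (hmem x).2, hle⟩
  -- The least maximiser is at most `c` exactly when the maximum over `[0, c]` already equals that
  -- over `[0, 1]`, a closed condition on `x`.
  refine measurable_of_Iic fun c => ?_
  rcases lt_or_ge c 0 with hc | hc
  · convert MeasurableSet.empty
    ext x
    simpa using hc.trans_le (hmem x).1.1
  rcases le_or_gt 1 c with hc1 | hc1
  · convert MeasurableSet.univ
    ext x
    simpa using (hmem x).1.2.trans hc1
  have : (fun x => sInf (S x)) ⁻¹' Iic c = {x | V x ≤ sSup (f x '' Icc 0 c)} := by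
    ext x
    constructor
    · intro h
      exact (hmem x).2.trans (le_csSup (hbdd x c) (mem_image_of_mem _ ⟨(hmem x).1.1, h⟩))
    · intro h
      obtain ⟨s, hs, hs'⟩ := hattained x c hc
      have hsS : s ∈ S x := ⟨⟨hs.1, hs.2.trans hc1.le⟩, (mem_ofPred_eq ▸ h).trans hs'.le⟩
      exact (csInf_le (hScompact x).bddBelow hsS).trans hs.2
  rw [this]
  exact (isClosed_le (hV 1) (hV c)).measurableSet

/-! ### Finite transport problems with measurable solutions -/

/-- `π` is a transport plan moving part of the mass `p` to part of the mass `q`, using only the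
pairs in `E`. -/
structure IsPartialPlan {I : Type*} [Fintype I] (E : Finset (I × I)) (p q : I → ℝ)
    (π : I × I → ℝ) : Prop where
  nonneg : ∀ e, 0 ≤ π e
  eq_zero : ∀ e, e ∉ E → π e = 0
  row_le : ∀ i, ∑ j, π (i, j) ≤ p i
  col_le : ∀ j, ∑ i, π (i, j) ≤ q j

theorem sum_single_row {I : Type*} [Fintype I] [DecidableEq I] (a b i : I) (t : ℝ) :
    ∑ j, (Pi.single (a, b) t : I × I → ℝ) (i, j) = (Pi.single a t : I → ℝ) i := by
  rcases eq_or_ne i a with rfl | h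
  · simp [Pi.single_apply]
  · simp [h]

theorem sum_single_col {I : Type*} [Fintype I] [DecidableEq I] (a b j : I) (t : ℝ) :
    ∑ i, (Pi.single (a, b) t : I × I → ℝ) (i, j) = (Pi.single b t : I → ℝ) j := by
  rcases eq_or_ne j b with rfl | h
  · simp [Pi.single_apply]
  · simp [h]

/-- With `sub_single`, this is the dynamic programming recursion: fix the mass sent along `(a, b)`,
then plan on `E` with the reduced marginals. -/
theorem IsPartialPlan.add_single {I : Type*} [Fintype I] [DecidableEq I] {E : Finset (I × I)}
    {p q : I → ℝ} {a b : I} {t : ℝ} (ht : 0 ≤ t) {π : I × I → ℝ}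
    (h : IsPartialPlan E (p - Pi.single a t) (q - Pi.single b t) π) :
    IsPartialPlan (insert (a, b) E) p q (π + Pi.single (a, b) t) where
  nonneg e := add_nonneg (h.nonneg e) (by rw [Pi.single_apply]; split_ifs <;> simp [ht])
  eq_zero e he := by
    rw [Finset.mem_insert, not_or] at he
    simp [h.eq_zero e he.2, he.1]
  row_le i := by
    have := h.row_le i
    simp only [Pi.add_apply, Finset.sum_add_distrib, sum_single_row, Pi.sub_apply] at this ⊢
    linarith
  col_le j := by
    have := h.col_le j
    simp only [Pi.add_apply, Finset.sum_add_distrib, sum_single_col, Pi.sub_apply] at this ⊢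
    linarith

theorem IsPartialPlan.sub_single {I : Type*} [Fintype I] [DecidableEq I] {E : Finset (I × I)}
    {p q : I → ℝ} {a b : I} {π : I × I → ℝ} (h : IsPartialPlan (insert (a, b) E) p q π) :
    IsPartialPlan E (p - Pi.single a (π (a, b))) (q - Pi.single b (π (a, b)))
      (π - Pi.single (a, b) (π (a, b))) where
  nonneg e := by
    rcases eq_or_ne e (a, b) with rfl | he
    · simp
    · simpa [Pi.single_apply, he] using h.nonneg e
  eq_zero e he := by
    rcases eq_or_ne e (a, b) with rfl | hne
    · simp
    · simpa [Pi.single_apply, hne] using h.eq_zero e (by simp [he, hne])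
  row_le i := by
    have := h.row_le i
    simp only [Pi.sub_apply, Finset.sum_sub_distrib, sum_single_row]
    linarith
  col_le j := by
    have := h.col_le j
    simp only [Pi.sub_apply, Finset.sum_sub_distrib, sum_single_col]
    linarith

theorem IsPartialPlan.le_min {I : Type*} [Fintype I] {E : Finset (I × I)}
    {p q : I → ℝ} {π : I × I → ℝ} (h : IsPartialPlan E p q π) (a b : I) :
    π (a, b) ≤ min (p a) (q b) :=
  _root_.le_min
    ((Finset.single_le_sum (f := fun j => π (a, j)) (fun _ _ => h.nonneg _)
      (Finset.mem_univ b)).trans (h.row_le a))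
    ((Finset.single_le_sum (f := fun i => π (i, b)) (fun _ _ => h.nonneg _)
      (Finset.mem_univ a)).trans (h.col_le b))

/-- A partial plan of maximal mass can be chosen as a measurable function of the marginals. -/
theorem exists_measurable_max_partialPlan {I : Type*} [Fintype I] [DecidableEq I]
    (E : Finset (I × I)) :
    ∃ (V : (I → ℝ) × (I → ℝ) → ℝ) (G : (I → ℝ) × (I → ℝ) → I × I → ℝ),
      Continuous V ∧ Measurable G ∧ ∀ p q : I → ℝ, 0 ≤ p → 0 ≤ q →
        IsPartialPlan E p q (G (p, q)) ∧ ∑ e, G (p, q) e = V (p, q) ∧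
        ∀ π, IsPartialPlan E p q π → ∑ e, π e ≤ V (p, q) := by
  induction E using Finset.induction_on with
  | empty =>
    refine ⟨0, 0, continuous_zero, measurable_zero, fun p q hp hq =>
      ⟨⟨by simp, by simp, by simpa using fun i => hp i,
        by simpa using fun j => hq j⟩, by simp, fun π hπ => ?_⟩⟩
    exact (Finset.sum_eq_zero fun e _ => hπ.eq_zero e (Finset.notMem_empty e)).le
  | insert e E he ih =>
    obtain ⟨a, b⟩ := e
    obtain ⟨V, G, hV, hG, hVG⟩ := ih
    let m : (I → ℝ) × (I → ℝ) → ℝ := fun x => min (x.1 a) (x.2 b)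
    let R : (I → ℝ) × (I → ℝ) → ℝ → (I → ℝ) × (I → ℝ) := fun x t =>
      (x.1 - Pi.single a t, x.2 - Pi.single b t)
    have hm : Continuous m := by fun_prop
    have hsingle (c : I) : Continuous fun t : ℝ => (Pi.single c t : I → ℝ) :=
      continuous_single (A := fun _ : I => ℝ) c
    have hR : Continuous (Function.uncurry R) := by
      refine Continuous.prodMk ?_ ?_
      · exact (continuous_fst.fst).sub ((hsingle a).comp continuous_snd)
      · exact (continuous_fst.snd).sub ((hsingle b).comp continuous_snd)
    have hRm (x : (I → ℝ) × (I → ℝ)) (hx : 0 ≤ x.1 ∧ 0 ≤ x.2) (t : ℝ) (ht : t ≤ m x) :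
        0 ≤ (R x t).1 ∧ 0 ≤ (R x t).2 := by
      constructor
      · intro i
        have := hx.1 i
        have := ht.trans (min_le_left _ _)
        rcases eq_or_ne i a with rfl | h <;> simp_all [R]
      · intro i
        have := hx.2 i
        have := ht.trans (min_le_right _ _)
        rcases eq_or_ne i b with rfl | h <;> simp_all [R]
    -- The mass on `(a, b)` ranges over `[0, m x]`; writing it as `s * m x` makes the interval
    -- independent of `x`.
    have hF : Continuous (Function.uncurry fun x s => s * m x + V (R x (s * m x))) := by
      have h1 : Continuous fun y : ((I → ℝ) × (I → ℝ)) × ℝ => y.2 * m y.1 := by fun_prop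
      exact h1.add (hV.comp (hR.comp (continuous_fst.prodMk h1)))
    obtain ⟨V', τ, hV', hτ, hτ01, hτV, hmax⟩ := exists_measurable_argmax_Icc hF
    have hτm : Measurable fun x => τ x * m x := hτ.mul hm.measurable
    refine ⟨V', fun x => G (R x (τ x * m x)) + Pi.single (a, b) (τ x * m x), hV', ?_, ?_⟩
    · refine (hG.comp (hR.measurable.comp (measurable_id.prodMk hτm))).add ?_
      exact (continuous_single (A := fun _ : I × I => ℝ) (a, b)).measurable.comp hτm
    intro p q hp hq
    have hm0 : 0 ≤ m (p, q) := le_min (hp a) (hq b)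
    have ht0 : 0 ≤ τ (p, q) * m (p, q) := mul_nonneg (hτ01 _).1 hm0
    have htm : τ (p, q) * m (p, q) ≤ m (p, q) := mul_le_of_le_one_left hm0 (hτ01 _).2
    obtain ⟨hp', hq'⟩ := hRm (p, q) ⟨hp, hq⟩ _ htm
    obtain ⟨h1, h2, -⟩ := hVG _ _ hp' hq'
    refine ⟨h1.add_single ht0, ?_, fun π hπ => ?_⟩
    · rw [← hτV]
      simp only [Pi.add_apply, Finset.sum_add_distrib, Prod.mk.eta] at h2 ⊢
      rw [h2, Finset.sum_pi_single']
      simp [add_comm]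
    · have hπm : π (a, b) ≤ m (p, q) := hπ.le_min a b
      obtain ⟨s, hs, hsm⟩ : ∃ s ∈ Icc (0 : ℝ) 1, s * m (p, q) = π (a, b) := by
        rcases hm0.eq_or_lt with h0 | h0
        · exact ⟨0, by simp, by linarith [hπ.nonneg (a, b)]⟩
        · exact ⟨π (a, b) / m (p, q), ⟨div_nonneg (hπ.nonneg _) hm0, div_le_one_of_le₀ hπm hm0⟩,
            div_mul_cancel₀ _ h0.ne'⟩
      obtain ⟨hp', hq'⟩ := hRm (p, q) ⟨hp, hq⟩ _ hπm
      have := (hVG _ _ hp' hq').2.2 _ hπ.sub_single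
      have h3 := hmax (p, q) s hs
      simp only [hsm] at h3
      simp only [Pi.sub_apply, Finset.sum_sub_distrib, Prod.mk.eta] at this
      rw [Finset.sum_pi_single'] at this
      simp only [Finset.mem_univ, if_true] at this
      linarith

/-- A full plan between two probability vectors, charging `E` with maximal mass, can be chosen as
a measurable function of the two vectors. -/
theorem exists_measurable_max_plan {I : Type*} [Fintype I] [DecidableEq I] (E : Finset (I × I)) :
    ∃ G : (I → ℝ) × (I → ℝ) → I × I → ℝ, Measurable G ∧ ∀ p q : I → ℝ, 0 ≤ p → 0 ≤ q →
      ∑ i, p i = 1 → ∑ j, q j = 1 →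
        (∀ e, 0 ≤ G (p, q) e) ∧ (∀ i, ∑ j, G (p, q) (i, j) = p i) ∧
        (∀ j, ∑ i, G (p, q) (i, j) = q j) ∧
        ∀ π, IsPartialPlan E p q π → ∑ e, π e ≤ ∑ e ∈ E, G (p, q) e := by
  obtain ⟨V, G, -, hG, hVG⟩ := exists_measurable_max_partialPlan E
  let r : (I → ℝ) × (I → ℝ) → I → ℝ := fun x i => x.1 i - ∑ j, G x (i, j)
  let c : (I → ℝ) × (I → ℝ) → I → ℝ := fun x j => x.2 j - ∑ i, G x (i, j)
  have hGe (e : I × I) : Measurable fun x => G x e := (measurable_pi_apply e).comp hG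
  -- The unused masses `r` and `c` have equal totals and are joined by a normalised product. If the
  -- total is `0`, both vanish and division by zero gives the correct value `0`.
  refine ⟨fun x e => G x e + r x e.1 * c x e.2 / ∑ i, r x i, ?_, ?_⟩
  · refine measurable_pi_lambda _ fun e => ?_
    have hr (i : I) : Measurable fun x => r x i := by fun_prop
    have hc (i : I) : Measurable fun x => c x i := by fun_prop
    fun_prop
  intro p q hp hq hp1 hq1
  obtain ⟨h1, h2, h3⟩ := hVG p q hp hq
  have hr0 (i : I) : 0 ≤ r (p, q) i := sub_nonneg.2 (h1.row_le i)
  have hc0 (i : I) : 0 ≤ c (p, q) i := sub_nonneg.2 (h1.col_le i)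
  have hrc : ∑ i, r (p, q) i = ∑ j, c (p, q) j := by
    simp only [r, c, Finset.sum_sub_distrib, hp1, hq1]
    rw [Finset.sum_comm]
  have hres0 (e : I × I) : 0 ≤ r (p, q) e.1 * c (p, q) e.2 / ∑ i, r (p, q) i :=
    div_nonneg (mul_nonneg (hr0 _) (hc0 _)) (Finset.sum_nonneg fun i _ => hr0 i)
  have hdiv (f : I → ℝ) (hf : ∀ i, 0 ≤ f i) (i : I) : f i * (∑ j, f j) / (∑ j, f j) = f i := by
    by_cases h : ∑ j, f j = 0
    · rw [(Finset.sum_eq_zero_iff_of_nonneg fun i _ => hf i).1 h i (Finset.mem_univ i)]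
      simp
    · exact mul_div_cancel_right₀ _ h
  refine ⟨fun e => add_nonneg (h1.nonneg e) (hres0 e), fun i => ?_, fun j => ?_, fun π hπ => ?_⟩
  · simp only [Finset.sum_add_distrib]
    rw [← Finset.sum_div, ← Finset.mul_sum, ← hrc, hdiv _ hr0]
    simp [r]
  · simp only [Finset.sum_add_distrib]
    rw [← Finset.sum_div, ← Finset.sum_mul, mul_comm, hrc, hdiv _ hc0]
    simp [c]
  · refine (h3 π hπ).trans ?_
    rw [← h2, ← Finset.sum_subset (Finset.subset_univ E) fun e _ he => h1.eq_zero e he]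
    exact Finset.sum_le_sum fun e _ => le_add_of_nonneg_right (hres0 e)

/-! ### Weak measurability and discretisation of the space -/

/-- A map that is measurable for the Borel σ-algebra of the weak topology is measurable as a
measure-valued map. -/
theorem measurable_toMeasure {X : Type*} [PseudoMetricSpace X] [MeasurableSpace X] [BorelSpace X]
    {Z : Type*} [MeasurableSpace Z] {μ : Z → ProbabilityMeasure X}
    (hμ : Measurable[_, borel (ProbabilityMeasure X)] μ) :
    Measurable fun z => (μ z : Measure X) := by
  refine Measurable.measure_of_isPiSystem_of_isProbabilityMeasure
    ((BorelSpace.measurable_eq (α := X)).trans borel_eq_generateFrom_isClosed)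
    isPiSystem_isClosed fun F hF => ?_
  have hδ (n : ℕ) : (0 : ℝ) < 1 / (n + 1) := Nat.one_div_pos_of_nat
  -- The indicator of a closed set is a limit of continuous functions, whose integrals are weakly
  -- continuous in the measure.
  refine measurable_of_tendsto_metrizable
    (f := fun (n : ℕ) z => ∫⁻ x, (thickenedIndicator (hδ n) F x : ℝ≥0∞) ∂(μ z : Measure X))
    (fun n => ?_) (tendsto_pi_nhds.2 fun z => tendsto_lintegral_thickenedIndicator_of_isClosed
      _ hF hδ tendsto_one_div_add_atTop_nhds_zero_nat)
  have hcont := ProbabilityMeasure.continuous_testAgainstNN_eval (thickenedIndicator (hδ n) F)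
  let : MeasurableSpace (ProbabilityMeasure X) := borel _
  have : BorelSpace (ProbabilityMeasure X) := ⟨rfl⟩
  have h := (hcont.measurable.comp hμ).coe_nnreal_ennreal
  simp only [Function.comp_def, FiniteMeasure.testAgainstNN_coe_eq] at h
  exact h

/-- A compact metric space has finite measurable classifications with small classes. -/
theorem exists_measurable_classifier {X : Type*} [MetricSpace X] [CompactSpace X] [Nonempty X]
    [MeasurableSpace X] [BorelSpace X] {δ : ℝ} (hδ : 0 < δ) :
    ∃ (N : ℕ) (ι : X → Fin N) (a : Fin N → X), Measurable ι ∧ ∀ x, dist (a (ι x)) x ≤ δ := by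
  obtain ⟨t, ht⟩ := isCompact_univ.elim_finite_subcover
    (fun k : ℕ => Metric.ball (TopologicalSpace.denseSeq X k) δ) (fun _ => Metric.isOpen_ball)
    (fun x _ => by
      obtain ⟨k, hk⟩ := (TopologicalSpace.denseRange_denseSeq X).exists_dist_lt x hδ
      exact mem_iUnion.2 ⟨k, hk⟩)
  let e := TopologicalSpace.denseSeq X
  let N := t.sup id
  refine ⟨N + 1, fun x => ⟨SimpleFunc.nearestPtInd e N x,
    Nat.lt_succ_of_le (SimpleFunc.nearestPtInd_le e N x)⟩, fun i => e i, ?_, fun x => ?_⟩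
  · refine measurable_to_countable' fun i => ?_
    convert (SimpleFunc.nearestPtInd e N).measurableSet_fiber i using 1
    ext x
    simp [Fin.ext_iff]
  · obtain ⟨k, hk, hx⟩ := mem_iUnion₂.1 (ht (mem_univ x))
    have h := SimpleFunc.edist_nearestPt_le e x (Finset.le_sup (f := id) hk : k ≤ N)
    have h2 : dist (SimpleFunc.nearestPt e N x) x ≤ dist (e k) x := by
      rwa [edist_dist, edist_dist, ENNReal.ofReal_le_ofReal_iff dist_nonneg] at h
    refine h2.trans ?_
    rw [dist_comm]
    exact (Metric.mem_ball.1 hx).le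

/-! ### From a finite plan to a coupling -/

/-- The measure on `X × X` that distributes the mass `π (i, j)` over the product of the classes
`i` and `j`, proportionally to `μ₁ ⊗ μ₂`. -/
noncomputable def planMeasure {X I : Type*} [MeasurableSpace X] [Fintype I] (ι : X → I)
    (μ₁ μ₂ : Measure X) (π : I × I → ℝ) : Measure (X × X) :=
  ∑ e : I × I, ENNReal.ofReal (π e / (μ₁.real (ι ⁻¹' {e.1}) * μ₂.real (ι ⁻¹' {e.2}))) •
    (μ₁.restrict (ι ⁻¹' {e.1})).prod (μ₂.restrict (ι ⁻¹' {e.2}))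

section planMeasure

variable {X I : Type*} [MeasurableSpace X] [Fintype I] {ι : X → I} {μ₁ μ₂ : Measure X}
  [IsProbabilityMeasure μ₁] [IsProbabilityMeasure μ₂] {π : I × I → ℝ}

/-- Each block receives exactly its planned mass. An empty block is harmless: `π (i, j)` is bounded
by both marginals, so it is `0` there. -/
theorem ofReal_plan_mul (hπ : ∀ e, 0 ≤ π e) (hrow : ∀ i, ∑ j, π (i, j) = μ₁.real (ι ⁻¹' {i}))
    (hcol : ∀ j, ∑ i, π (i, j) = μ₂.real (ι ⁻¹' {j})) (i j : I) :
    ENNReal.ofReal (π (i, j) / (μ₁.real (ι ⁻¹' {i}) * μ₂.real (ι ⁻¹' {j}))) *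
      (μ₁ (ι ⁻¹' {i}) * μ₂ (ι ⁻¹' {j})) = ENNReal.ofReal (π (i, j)) := by
  rw [← ofReal_measureReal (μ := μ₁), ← ofReal_measureReal (μ := μ₂),
    ← ENNReal.ofReal_mul measureReal_nonneg, ← ENNReal.ofReal_mul (div_nonneg (hπ _)
      (mul_nonneg measureReal_nonneg measureReal_nonneg))]
  congr 1
  have h1 : π (i, j) ≤ μ₁.real (ι ⁻¹' {i}) := (hrow i).symm ▸
    Finset.single_le_sum (f := fun j => π (i, j)) (fun j _ => hπ _) (Finset.mem_univ j)
  have h2 : π (i, j) ≤ μ₂.real (ι ⁻¹' {j}) := (hcol j).symm ▸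
    Finset.single_le_sum (f := fun i => π (i, j)) (fun i _ => hπ _) (Finset.mem_univ i)
  by_cases h : μ₁.real (ι ⁻¹' {i}) * μ₂.real (ι ⁻¹' {j}) = 0
  · rw [h, mul_zero]
    rcases mul_eq_zero.1 h with h | h
    · exact le_antisymm (hπ _) (h ▸ h1)
    · exact le_antisymm (hπ _) (h ▸ h2)
  · exact div_mul_cancel₀ _ h

theorem map_swap_planMeasure :
    (planMeasure ι μ₁ μ₂ π).map Prod.swap = planMeasure ι μ₂ μ₁ (π ∘ Prod.swap) := by
  ext s hs
  rw [Measure.map_apply measurable_swap hs, planMeasure, planMeasure]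
  simp only [Measure.coe_finsetSum, Finset.sum_apply, Measure.smul_apply, smul_eq_mul]
  rw [← (Equiv.prodComm I I).sum_comp]
  refine Finset.sum_congr rfl fun e _ => ?_
  rw [← Measure.map_apply measurable_swap hs, Measure.prod_swap]
  simp [mul_comm]

variable [MeasurableSpace I] [MeasurableSingletonClass I]

theorem sum_restrict_fiber (hι : Measurable ι) (μ : Measure X) :
    ∑ i, μ.restrict (ι ⁻¹' {i}) = μ := by
  ext s hs
  simp only [Measure.coe_finsetSum, Finset.sum_apply, Measure.restrict_apply hs]
  have h := measure_biUnion_finset (μ := μ) (s := Finset.univ) (f := fun i => s ∩ ι ⁻¹' {i})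
    (fun i _ j _ hij => by
      rw [Function.onFun, Set.disjoint_left]
      rintro x ⟨-, hi⟩ ⟨-, hj⟩
      exact hij (hi.symm.trans hj))
    (fun i _ => hs.inter (hι (measurableSet_singleton i)))
  rw [← h]
  congr 1
  ext x
  simp

theorem map_fst_planMeasure (hι : Measurable ι) (hπ : ∀ e, 0 ≤ π e)
    (hrow : ∀ i, ∑ j, π (i, j) = μ₁.real (ι ⁻¹' {i}))
    (hcol : ∀ j, ∑ i, π (i, j) = μ₂.real (ι ⁻¹' {j})) :
    (planMeasure ι μ₁ μ₂ π).map Prod.fst = μ₁ := by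
  conv_rhs => rw [← sum_restrict_fiber hι μ₁]
  ext s hs
  have hfst : MeasurableSet (Prod.fst ⁻¹' s : Set (X × X)) := measurable_fst hs
  rw [Measure.map_apply measurable_fst hs, planMeasure]
  simp only [Measure.coe_finsetSum, Finset.sum_apply, Measure.smul_apply, smul_eq_mul]
  rw [Fintype.sum_prod_type]
  refine Finset.sum_congr rfl fun i _ => ?_
  have hset : (Prod.fst ⁻¹' s : Set (X × X)) = s ×ˢ univ := by ext; simp
  simp only [hset, Measure.prod_prod, Measure.restrict_apply_univ, Measure.restrict_apply hs]
  by_cases h0 : μ₁ (ι ⁻¹' {i}) = 0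
  · simp [measure_mono_null (inter_subset_right : s ∩ ι ⁻¹' {i} ⊆ _) h0]
  -- The row condition says that the weights of row `i` add up to `1` once the nonzero mass of class
  -- `i` is cancelled.
  have hsum : (∑ j, ENNReal.ofReal (π (i, j) / (μ₁.real (ι ⁻¹' {i}) * μ₂.real (ι ⁻¹' {j}))) *
      μ₂ (ι ⁻¹' {j})) * μ₁ (ι ⁻¹' {i}) = 1 * μ₁ (ι ⁻¹' {i}) := by
    rw [one_mul, Finset.sum_mul]
    calc _ = ∑ j, ENNReal.ofReal (π (i, j)) := Finset.sum_congr rfl fun j _ => by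
          rw [← ofReal_plan_mul hπ hrow hcol i j]; ring
      _ = _ := by
          rw [← ENNReal.ofReal_sum_of_nonneg fun j _ => hπ _, hrow, ofReal_measureReal]
  have h1 := (ENNReal.mul_left_inj h0 (measure_ne_top _ _)).1 hsum
  calc _ = (∑ j, ENNReal.ofReal (π (i, j) / (μ₁.real (ι ⁻¹' {i}) * μ₂.real (ι ⁻¹' {j}))) *
        μ₂ (ι ⁻¹' {j})) * μ₁ (s ∩ ι ⁻¹' {i}) := by
        rw [Finset.sum_mul]
        exact Finset.sum_congr rfl fun j _ => by ring
    _ = _ := by rw [h1, one_mul]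

theorem map_snd_planMeasure (hι : Measurable ι) (hπ : ∀ e, 0 ≤ π e)
    (hrow : ∀ i, ∑ j, π (i, j) = μ₁.real (ι ⁻¹' {i}))
    (hcol : ∀ j, ∑ i, π (i, j) = μ₂.real (ι ⁻¹' {j})) :
    (planMeasure ι μ₁ μ₂ π).map Prod.snd = μ₂ := by
  have h := map_fst_planMeasure (μ₁ := μ₂) (μ₂ := μ₁) (π := π ∘ Prod.swap) hι (fun e => hπ _)
    hcol hrow
  rwa [← map_swap_planMeasure, Measure.map_map measurable_fst measurable_swap] at h

theorem planMeasure_apply_le (hι : Measurable ι) (hπ : ∀ e, 0 ≤ π e)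
    (hrow : ∀ i, ∑ j, π (i, j) = μ₁.real (ι ⁻¹' {i}))
    (hcol : ∀ j, ∑ i, π (i, j) = μ₂.real (ι ⁻¹' {j})) {E : Finset (I × I)} [DecidableEq I]
    {D : Set (X × X)} (hD : ∀ x ∈ D, (ι x.1, ι x.2) ∉ E) :
    planMeasure ι μ₁ μ₂ π D ≤ ENNReal.ofReal (∑ e ∈ Eᶜ, π e) := by
  rw [planMeasure, ENNReal.ofReal_sum_of_nonneg fun e _ => hπ e]
  simp only [Measure.coe_finsetSum, Finset.sum_apply, Measure.smul_apply, smul_eq_mul]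
  rw [← Finset.sum_add_sum_compl E, Finset.sum_eq_zero, zero_add]
  · refine Finset.sum_le_sum fun e _ => ?_
    rw [← ofReal_plan_mul hπ hrow hcol e.1 e.2]
    refine mul_le_mul_right ((measure_mono (subset_univ D)).trans ?_) _
    rw [← univ_prod_univ, Measure.prod_prod]
    simp
  · intro e he
    rw [Measure.prod_restrict, Measure.restrict_apply₀', (_ : D ∩ _ = ∅)]
    · simp
    · ext x
      simp only [mem_inter_iff, mem_prod, mem_preimage, mem_singleton_iff, mem_empty_iff_false,
        iff_false, not_and]
      rintro hx h1 h2
      exact hD x hx (by rwa [h1, h2])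
    · exact ((hι (measurableSet_singleton _)).prod
        (hι (measurableSet_singleton _))).nullMeasurableSet

theorem measurable_planMeasure {Z : Type*} [MeasurableSpace Z] (hι : Measurable ι)
    (κ₁ κ₂ : Kernel Z X) [IsMarkovKernel κ₁] [IsMarkovKernel κ₂] {π : Z → I × I → ℝ}
    (hπ : Measurable π) : Measurable fun z => planMeasure ι (κ₁ z) (κ₂ z) (π z) := by
  have hA (i : I) : MeasurableSet (ι ⁻¹' {i}) := hι (measurableSet_singleton i)
  refine Measure.measurable_of_measurable_coe _ fun s hs => ?_
  simp only [planMeasure, Measure.coe_finsetSum, Finset.sum_apply, Measure.smul_apply,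
    smul_eq_mul]
  refine Finset.measurable_fun_sum _ fun e _ => Measurable.mul ?_ ?_
  · have h1 : Measurable fun z => (κ₁ z).real (ι ⁻¹' {e.1}) :=
      (κ₁.measurable_coe (hA _)).ennreal_toReal
    have h2 : Measurable fun z => (κ₂ z).real (ι ⁻¹' {e.2}) :=
      (κ₂.measurable_coe (hA _)).ennreal_toReal
    fun_prop
  · have h := (κ₁.restrict (hA e.1) ×ₖ κ₂.restrict (hA e.2)).measurable_coe hs
    simpa only [Kernel.prod_apply, Kernel.restrict_apply] using h

end planMeasure

/-! ### Comparison with the optimal cost and choice of scale -/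

theorem integral_dEps {X : Type u} [MetricSpace X] [SecondCountableTopology X]
    [MeasurableSpace X] [BorelSpace X] {Ω : Type v} [MeasurableSpace Ω] (P : Measure Ω)
    (ε : ℝ) {ζ₁ ζ₂ : Ω → X} (h₁ : Measurable ζ₁) (h₂ : Measurable ζ₂) :
    ∫ ω, dEps ε (ζ₁ ω) (ζ₂ ω) ∂P = P.real {ω | ε < dist (ζ₁ ω) (ζ₂ ω)} := by
  have hs : MeasurableSet {ω | ε < dist (ζ₁ ω) (ζ₂ ω)} :=
    measurableSet_lt measurable_const (h₁.dist h₂)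
  rw [← integral_indicator_one hs]
  rfl

/-- If pairs of points at distance at most `ε` have their classes in `E`, then the optimal cost
is bounded below by the mass that has to be moved outside of `E`. -/
theorem one_sub_le_optimalCost {X : Type u} {I : Type*} [MetricSpace X]
    [SecondCountableTopology X] [MeasurableSpace X] [BorelSpace X] [Fintype I] [MeasurableSpace I]
    [MeasurableSingletonClass I] {ι : X → I} (hι : Measurable ι) {E : Finset (I × I)} {ε : ℝ}
    (hE : ∀ x y, dist x y ≤ ε → (ι x, ι y) ∈ E) (μ₁ μ₂ : ProbabilityMeasure X) {m : ℝ}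
    (hm : ∀ π, IsPartialPlan E (fun i => (μ₁ : Measure X).real (ι ⁻¹' {i}))
      (fun j => (μ₂ : Measure X).real (ι ⁻¹' {j})) π → ∑ e, π e ≤ m) :
    1 - m ≤ optimalCost ε μ₁ μ₂ := by
  classical
  refine le_csInf (couplingCosts_nonempty ε μ₁ μ₂) ?_
  rintro c ⟨Ω, _, P, ζ₁, ζ₂, _, hζ, rfl⟩
  rw [integral_dEps P ε hζ.measurable_fst hζ.measurable_snd]
  let T : Ω → I × I := fun ω => (ι (ζ₁ ω), ι (ζ₂ ω))
  have hT : Measurable T := (hι.comp hζ.measurable_fst).prodMk (hι.comp hζ.measurable_snd)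
  have hTs (s : Finset (I × I)) : ∑ e ∈ s, P.real (T ⁻¹' {e}) = P.real (T ⁻¹' s) :=
    sum_measureReal_preimage_singleton s fun e _ => hT (measurableSet_singleton e)
  have hp (i : I) : P.real ((ι ∘ ζ₁) ⁻¹' {i}) = (μ₁ : Measure X).real (ι ⁻¹' {i}) := by
    rw [← hζ.map_fst, map_measureReal_apply hζ.measurable_fst (hι (measurableSet_singleton i))]
    rfl
  have hq (j : I) : P.real ((ι ∘ ζ₂) ⁻¹' {j}) = (μ₂ : Measure X).real (ι ⁻¹' {j}) := by
    rw [← hζ.map_snd, map_measureReal_apply hζ.measurable_snd (hι (measurableSet_singleton j))]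
    rfl
  -- The joint law of the two classes, cut down to `E`, competes in the finite problem.
  let π : I × I → ℝ := fun e => if e ∈ E then P.real (T ⁻¹' {e}) else 0
  have hπle (e : I × I) : π e ≤ P.real (T ⁻¹' {e}) := by
    by_cases h : e ∈ E <;> simp [π, h]
  have hπ := hm π
    { nonneg := fun e => by by_cases h : e ∈ E <;> simp [π, h]
      eq_zero := fun e he => by simp [π, he]
      row_le := fun i => by
        refine (Finset.sum_le_sum fun j _ => hπle (i, j)).trans ?_
        have h := hTs (Finset.univ.image fun j => (i, j))
        rw [Finset.sum_image fun a _ b _ hab => (Prod.ext_iff.1 hab).2] at h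
        rw [h, ← hp]
        refine measureReal_mono fun ω hω => ?_
        simp only [Finset.coe_image, Finset.coe_univ, image_univ, mem_preimage, mem_range] at hω
        obtain ⟨j, hj⟩ := hω
        exact (Prod.ext_iff.1 hj).1.symm
      col_le := fun j => by
        refine (Finset.sum_le_sum fun i _ => hπle (i, j)).trans ?_
        have h := hTs (Finset.univ.image fun i => (i, j))
        rw [Finset.sum_image fun a _ b _ hab => (Prod.ext_iff.1 hab).1] at h
        rw [h, ← hq]
        refine measureReal_mono fun ω hω => ?_
        simp only [Finset.coe_image, Finset.coe_univ, image_univ, mem_preimage, mem_range] at hω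
        obtain ⟨i, hi⟩ := hω
        exact (Prod.ext_iff.1 hi).2.symm }
  have hsum : ∑ e, π e = P.real (T ⁻¹' E) := by
    rw [← hTs, Finset.sum_ite_mem, Finset.univ_inter]
  have hcompl : P.real (T ⁻¹' E)ᶜ = 1 - P.real (T ⁻¹' E) :=
    probReal_compl_eq_one_sub (hT E.measurableSet)
  have hle : P.real (T ⁻¹' E)ᶜ ≤ P.real {ω | ε < dist (ζ₁ ω) (ζ₂ ω)} :=
    measureReal_mono fun ω hω => not_le.1 fun h => hω (hE _ _ h)
  linarith

/-- At a fixed scale `δ`, there is a measurable family of couplings that is optimal up to an error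
`4 * δ` in the radius. -/
theorem exists_kernel_coupling_scale {X : Type u} [MetricSpace X] [CompactSpace X] [Nonempty X]
    [MeasurableSpace X] [BorelSpace X] {Z : Type v} [MeasurableSpace Z]
    {μ₁ μ₂ : Z → ProbabilityMeasure X} (hμ₁ : Measurable fun z => (μ₁ z : Measure X))
    (hμ₂ : Measurable fun z => (μ₂ z : Measure X)) {η : Z → ℝ} (hη : Measurable η) {δ : ℝ}
    (hδ : 0 < δ) :
    ∃ ρ : Z → Measure (X × X), Measurable ρ ∧ ∀ z, (ρ z).map Prod.fst = μ₁ z ∧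
      (ρ z).map Prod.snd = μ₂ z ∧ ∀ ε, η z + 4 * δ ≤ ε →
        (ρ z).real {x | ε < dist x.1 x.2} ≤ optimalCost (η z) (μ₁ z) (μ₂ z) := by
  classical
  obtain ⟨N, ι, a, hι, ha⟩ := exists_measurable_classifier (X := X) hδ
  choose G hG hGplan using fun E : Finset (Fin N × Fin N) => exists_measurable_max_plan E
  have hA (i : Fin N) : MeasurableSet (ι ⁻¹' {i}) := hι (measurableSet_singleton i)
  let κ₁ : Kernel Z X := ⟨fun z => μ₁ z, hμ₁⟩
  let κ₂ : Kernel Z X := ⟨fun z => μ₂ z, hμ₂⟩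
  have : IsMarkovKernel κ₁ := ⟨fun z => inferInstanceAs (IsProbabilityMeasure (μ₁ z : Measure X))⟩
  have : IsMarkovKernel κ₂ := ⟨fun z => inferInstanceAs (IsProbabilityMeasure (μ₂ z : Measure X))⟩
  let p : Z → Fin N → ℝ := fun z i => (μ₁ z : Measure X).real (ι ⁻¹' {i})
  let q : Z → Fin N → ℝ := fun z i => (μ₂ z : Measure X).real (ι ⁻¹' {i})
  have hp : Measurable p :=
    measurable_pi_lambda _ fun i => (κ₁.measurable_coe (hA i)).ennreal_toReal
  have hq : Measurable q :=
    measurable_pi_lambda _ fun i => (κ₂.measurable_coe (hA i)).ennreal_toReal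
  have hsum (μ : ProbabilityMeasure X) : ∑ i, (μ : Measure X).real (ι ⁻¹' {i}) = 1 := by
    rw [sum_measureReal_preimage_singleton _ fun i _ => hA i]
    simp
  let E : Z → Finset (Fin N × Fin N) := fun z => {e | dist (a e.1) (a e.2) ≤ η z + 2 * δ}
  -- `E z` takes finitely many values, so the solutions `G` for the separate sets glue measurably.
  let : MeasurableSpace (Finset (Fin N × Fin N)) := ⊤
  have hE : Measurable E := by
    refine measurable_to_countable' fun S => ?_
    have : E ⁻¹' {S} = ⋂ e, {z | dist (a e.1) (a e.2) ≤ η z + 2 * δ ↔ e ∈ S} := by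
      ext z
      simp [E, Finset.ext_iff]
    rw [this]
    refine MeasurableSet.iInter fun e => ?_
    have h : MeasurableSet {z | dist (a e.1) (a e.2) ≤ η z + 2 * δ} :=
      measurableSet_le measurable_const (hη.add_const _)
    exact h.iff (.const _)
  let π : Z → Fin N × Fin N → ℝ := fun z => G (E z) (p z, q z)
  have hπ : Measurable π := by
    have h : Measurable fun y : Finset (Fin N × Fin N) × _ => G y.1 y.2 :=
      measurable_from_prod_countable_right hG
    exact h.comp (hE.prodMk (hp.prodMk hq))
  refine ⟨fun z => planMeasure ι (μ₁ z) (μ₂ z) (π z), measurable_planMeasure hι κ₁ κ₂ hπ,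
    fun z => ?_⟩
  obtain ⟨h0, hrow, hcol, hmax⟩ := hGplan (E z) (p z) (q z) (fun i => measureReal_nonneg)
    (fun i => measureReal_nonneg) (hsum _) (hsum _)
  refine ⟨map_fst_planMeasure hι h0 hrow hcol, map_snd_planMeasure hι h0 hrow hcol,
    fun ε hε => ?_⟩
  refine le_trans ?_ (one_sub_le_optimalCost hι (E := E z) (fun x y hxy => ?_) _ _ hmax)
  · have htot : ∑ e, π z e = 1 := by
      rw [Fintype.sum_prod_type]
      exact (Finset.sum_congr rfl fun i _ => hrow i).trans (hsum _)
    have hle := planMeasure_apply_le hι h0 hrow hcol (E := E z)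
      (D := {x | ε < dist x.1 x.2}) fun x hx he => by
        have hd : dist (a (ι x.1)) (a (ι x.2)) ≤ η z + 2 * δ := (Finset.mem_filter.1 he).2
        have hlt : ε < dist x.1 x.2 := hx
        have h1 := ha x.1
        have h2 := ha x.2
        have h3 := dist_triangle4 x.1 (a (ι x.1)) (a (ι x.2)) x.2
        rw [dist_comm x.1 (a (ι x.1))] at h3
        linarith
    have h := ENNReal.toReal_le_of_le_ofReal (Finset.sum_nonneg fun e _ => h0 e) hle
    refine h.trans_eq ?_
    rw [← htot, ← Finset.sum_add_sum_compl (E z)]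
    exact (add_sub_cancel_left _ _).symm
  · refine Finset.mem_filter.2 ⟨Finset.mem_univ _, ?_⟩
    have h1 := ha x
    have h2 := ha y
    have h3 := dist_triangle4 (a (ι x)) x y (a (ι y))
    rw [dist_comm y (a (ι y))] at h3
    linarith

theorem exists_kernel_coupling {X : Type u} [MetricSpace X] [CompactSpace X] [Nonempty X]
    [MeasurableSpace X] [BorelSpace X] {Z : Type v} [MeasurableSpace Z]
    {μ₁ μ₂ : Z → ProbabilityMeasure X} (hμ₁ : Measurable fun z => (μ₁ z : Measure X))
    (hμ₂ : Measurable fun z => (μ₂ z : Measure X)) {η ε : Z → ℝ} (hη : Measurable η)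
    (hε : Measurable ε) (hlt : ∀ z, η z < ε z) :
    ∃ κ : Kernel Z (X × X), ∀ z, (κ z).map Prod.fst = μ₁ z ∧ (κ z).map Prod.snd = μ₂ z ∧
      (κ z).real {x | ε z < dist x.1 x.2} ≤ optimalCost (η z) (μ₁ z) (μ₂ z) := by
  choose ρ hρ hρz using fun k : ℕ => exists_kernel_coupling_scale hμ₁ hμ₂ hη
    (Nat.one_div_pos_of_nat : (0 : ℝ) < 1 / ((k : ℝ) + 1))
  -- Chosen so that the discretisation error `4 / (k + 1)` fits into the gap `ε z - η z`.
  let k : Z → ℕ := fun z => ⌈4 / (ε z - η z)⌉₊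
  have hk : Measurable k := Nat.measurable_ceil.comp (by fun_prop)
  have hmeas : Measurable fun y : ℕ × Z => ρ y.1 y.2 := measurable_from_prod_countable_right hρ
  refine ⟨⟨fun z => ρ (k z) z, hmeas.comp (hk.prodMk measurable_id)⟩, fun z => ?_⟩
  obtain ⟨h1, h2, h3⟩ := hρz (k z) z
  refine ⟨h1, h2, h3 _ ?_⟩
  have hpos : 0 < ε z - η z := sub_pos.2 (hlt z)
  have hceil : 4 / (ε z - η z) ≤ k z := Nat.le_ceil _
  have hk0 : (0 : ℝ) < k z + 1 := by positivity
  have : 4 * (1 / ((k z : ℝ) + 1)) ≤ ε z - η z := by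
    rw [mul_one_div, div_le_iff₀ hk0]
    rw [div_le_iff₀ hpos] at hceil
    nlinarith
  linarith

end EpsOptimal

/-! ### Realisation by random variables -/

theorem proposition5p4 {Y : Type u} [NormedAddCommGroup Y] [NormedSpace ℝ Y] [CompleteSpace Y]
    [MeasurableSpace Y] [BorelSpace Y] (X : Set Y) (hX : IsCompact X)
    {Z : Type v} [MeasurableSpace Z] (μ₁ μ₂ : Z → ProbabilityMeasure X)
    (hμ₁ : Measurable[_, borel (ProbabilityMeasure X)] μ₁)
    (hμ₂ : Measurable[_, borel (ProbabilityMeasure X)] μ₂)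
    (ε : Z → ℝ) (hε : Measurable ε) (hε_pos : ∀ z, 0 < ε z)
    (θ : ℝ) (hθ : θ ∈ Set.Ioo (0 : ℝ) 1) :
    ∃ (Ω : Type) (_ : MeasurableSpace Ω) (P : Measure Ω) (ξ₁ ξ₂ : Ω × Z → X),
      IsProbabilityMeasure P ∧
      Measurable (fun p => (ξ₁ p : Y)) ∧ Measurable (fun p => (ξ₂ p : Y)) ∧
      ∀ z, EpsOptimal.IsCoupling P (fun ω => ξ₁ (ω, z)) (fun ω => ξ₂ (ω, z)) (μ₁ z) (μ₂ z) ∧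
        ∫ ω, EpsOptimal.dEps (ε z) (ξ₁ (ω, z)) (ξ₂ (ω, z)) ∂P ≤
          EpsOptimal.optimalCost (θ * ε z) (μ₁ z) (μ₂ z) := by
  have : CompactSpace X := isCompact_iff_compactSpace.1 hX
  rcases isEmpty_or_nonempty X with hXe | hXne
  · have : IsEmpty Z := ⟨fun z => by
      obtain ⟨x⟩ := (μ₁ z : Measure X).nonempty_of_neZero
      exact hXe.false x⟩
    exact ⟨unitInterval, inferInstance, volume, fun p => isEmptyElim p.2,
      fun p => isEmptyElim p.2, inferInstance, measurable_of_empty _, measurable_of_empty _,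
      fun z => isEmptyElim z⟩
  obtain ⟨κ, hκ⟩ := EpsOptimal.exists_kernel_coupling (EpsOptimal.measurable_toMeasure hμ₁)
    (EpsOptimal.measurable_toMeasure hμ₂) (hε.const_mul θ) hε
    (fun z => mul_lt_of_lt_one_left (hε_pos z) hθ.2)
  have : ProbabilityTheory.IsMarkovKernel κ := ⟨fun z => by
    have h : IsProbabilityMeasure ((κ z).map Prod.fst) := (hκ z).1 ▸ inferInstance
    exact (Measure.isProbabilityMeasure_map_iff measurable_fst.aemeasurable).1 h⟩
  -- One uniform variable on `[0, 1]` serves all `z`: `f z` pushes it to `κ z`, with joint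
  -- measurability.
  obtain ⟨f, hf, hfκ⟩ := κ.exists_measurable_map_eq_unitInterval
  have hfz (z : Z) : Measurable (f z) := hf.of_uncurry_left
  have hswap : Measurable fun p : unitInterval × Z => f p.2 p.1 := hf.comp measurable_swap
  refine ⟨unitInterval, inferInstance, volume, fun p => (f p.2 p.1).1, fun p => (f p.2 p.1).2,
    inferInstance, hswap.fst.subtype_val, hswap.snd.subtype_val, fun z => ⟨?_, ?_⟩⟩
  · refine ⟨(hfz z).fst, (hfz z).snd, ?_, ?_⟩
    · rw [← (hκ z).1, ← hfκ, Measure.map_map measurable_fst (hfz z)]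
      rfl
    · rw [← (hκ z).2.1, ← hfκ, Measure.map_map measurable_snd (hfz z)]
      rfl
  · rw [EpsOptimal.integral_dEps _ _ (hfz z).fst (hfz z).snd]
    refine le_trans (le_of_eq ?_) (hκ z).2.2
    rw [← hfκ, map_measureReal_apply (hfz z)
      (measurableSet_lt measurable_const (measurable_fst.dist measurable_snd))]
    rfl
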